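/- Let $\Omega=\{0,1\}^{\infty}$ be the set of infinite binary sequences (paths). For $\omega\in\Omega$ and $t\ge 0$ let $\omega^t\subseteq\Omega$ be the cylinder of all paths that coincide with $\omega$ in the first $t$ coordinates, and let $\Sigma$ be any $\sigma$-algebra on $\Omega$ (its members are called events) that contains all cylinders. Let $\mathbb P$ be the set of finitely additive probabilities on $(\Omega,\Sigma)$. An opinion is a $P\in\mathbb P$ that is strongly nonatomic: for every event $E$ and every $\alpha\in[0,1]$ there is an event $F\subseteq E$ with $P(F)=\alpha P(E)$. For $P,Q\in\mathbb P$ write $Q\ll P$ if, for every sequence of events $(E_n)$, $P(E_n)\to 0$ implies $Q(E_n)\to 0$; say that $P$ merges with $Q$ if for every $\varepsilon>0$ $$\lim_{t\to\infty}Q\Bigl(\Bigl\{\omega:\ \sup_{E\in\Sigma}\bigl|P(E\mid\omega^t)-Q(E\mid\omega^t)\bigr|>\varepsilon\Bigr\}\Bigr)=0 .$$ Let $\Delta_{\mathrm{BD}}$ be the set of opinions $P$ with the Blackwell--Dubins property: $P$ merges with every $Q\in\mathbb P$ such that $Q\ll P$. A collection $\mathcal I$ of subsets of $\Omega$ is a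 strictly proper ideal if it is closed under taking subsets, closed under finite (pairwise) unions, and contains no cylinder. Theorem 4. For every strictly proper ideal $\mathcal I$ there exists an opinion $P\in\Delta_{\mathrm{BD}}$ such that $P(E)=0$ for every event $E\in\mathcal I$. Moreover, $P$ can be chosen to be an extreme point of the set of all finitely additive probabilities on $\Sigma$ that extend some finitely additive probability $\tilde\pi$ defined on $\mathcal A$, where $\mathcal A$ is the algebra of sets generated by the cylinders, the events in $\mathcal I$ and the events whose complement lies in $\mathcal I$. -/

import Mathlib

open Set Filter Topology

/-- Paths: infinite sequences of outcomes `0` (`false`) or `1` (`true`). -/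
abbrev BinPath : Type := ℕ → Bool

/-- The cylinder of length `t` with base `ω`: all paths which coincide with `ω` in the first
`t` periods. -/
abbrev cyl (ω : BinPath) (t : ℕ) : Set BinPath := PiNat.cylinder (E := fun _ => Bool) ω t

/-- The collection of all cylinders. -/
def cylinders : Set (Set BinPath) := {C | ∃ (ω : BinPath) (t : ℕ), C = cyl ω t}

/-- The collection of events of the `σ`-algebra `Sig`. -/
def events (Sig : MeasurableSpace BinPath) : Set (Set BinPath) := {E | @MeasurableSet BinPath Sig E}

/-- `P` is a finitely additive probability on the algebra of sets `𝒜`. A function on `𝒜` is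
represented by its extension by zero to all sets, so that two probabilities on `𝒜` are equal
exactly when they agree on `𝒜`. -/
structure IsFinAddProb (𝒜 : Set (Set BinPath)) (P : Set BinPath → ℝ) : Prop where
  nonneg : ∀ E ∈ 𝒜, 0 ≤ P E
  univ_eq_one : P univ = 1
  union_eq : ∀ E ∈ 𝒜, ∀ F ∈ 𝒜, Disjoint E F → P (E ∪ F) = P E + P F
  eq_zero_of_notMem : ∀ E, E ∉ 𝒜 → P E = 0

/-- `P` is strongly nonatomic on the events of `Sig`. -/
def StronglyNonatomic (Sig : MeasurableSpace BinPath) (P : Set BinPath → ℝ) : Prop :=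
  ∀ E ∈ events Sig, ∀ α ∈ Icc (0 : ℝ) 1, ∃ F ∈ events Sig, F ⊆ E ∧ P F = α * P E

/-- An opinion: a strongly nonatomic finitely additive probability on the events of `Sig`. -/
def IsOpinion (Sig : MeasurableSpace BinPath) (P : Set BinPath → ℝ) : Prop :=
  IsFinAddProb (events Sig) P ∧ StronglyNonatomic Sig P

/-- Absolute continuity `Q ≪ P` for finitely additive probabilities. -/
def AbsCont (Sig : MeasurableSpace BinPath) (Q P : Set BinPath → ℝ) : Prop :=
  ∀ E : ℕ → Set BinPath, (∀ n, E n ∈ events Sig) →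
    Tendsto (fun n => P (E n)) atTop (𝓝 0) → Tendsto (fun n => Q (E n)) atTop (𝓝 0)

/-- The conditional probability `P (E | C)`; it is only meaningful when `P C > 0`. -/
noncomputable def condProb (P : Set BinPath → ℝ) (E C : Set BinPath) : ℝ := P (E ∩ C) / P C

/-- The distance between the forecasts of `P` and `Q` conditional on the first `t` outcomes
of `ω`: the supremum over all events `E` of `|P (E | ω^t) - Q (E | ω^t)|`. -/
noncomputable def forecastDist (Sig : MeasurableSpace BinPath) (P Q : Set BinPath → ℝ)
    (ω : BinPath) (t : ℕ) : ℝ :=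
  ⨆ E : events Sig, |condProb P E (cyl ω t) - condProb Q E (cyl ω t)|

/-- `P` merges with `Q`: the distance between the forecasts tends to zero in `Q`-probability.
This notion is used only for `Q ≪ P`; then the conditional probabilities are genuine on every
cylinder with `Q (ω^t) > 0`, and the other cylinders of length `t`, of which there are finitely
many, have total `Q`-probability zero. -/
def Merges (Sig : MeasurableSpace BinPath) (P Q : Set BinPath → ℝ) : Prop :=
  ∀ ε : ℝ, 0 < ε → Tendsto (fun t : ℕ => Q {ω | ε < forecastDist Sig P Q ω t}) atTop (𝓝 0)

/-- The Blackwell--Dubins property: `P` merges with every finitely additive probability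
that is absolutely continuous with respect to `P`. -/
def BlackwellDubins (Sig : MeasurableSpace BinPath) (P : Set BinPath → ℝ) : Prop :=
  ∀ Q : Set BinPath → ℝ, IsFinAddProb (events Sig) Q → AbsCont Sig Q P → Merges Sig P Q

/-- `Δ_BD`: the set of all opinions that satisfy the Blackwell--Dubins property. -/
def DeltaBD (Sig : MeasurableSpace BinPath) : Set (Set BinPath → ℝ) :=
  {P | IsOpinion Sig P ∧ BlackwellDubins Sig P}

/-- A strictly proper ideal of subsets of the path space. -/
structure IsStrictlyProperIdeal (I : Set (Set BinPath)) : Prop where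
  mem_of_subset : ∀ S ∈ I, ∀ R, R ⊆ S → R ∈ I
  union_mem : ∀ R ∈ I, ∀ S ∈ I, R ∪ S ∈ I
  cylinder_notMem : ∀ C ∈ cylinders, C ∉ I

/-- The algebra of sets generated by the cylinders, the small events (those in `I`) and the
large events (those whose complement is in `I`). -/
def smallLargeAlgebra (Sig : MeasurableSpace BinPath) (I : Set (Set BinPath)) :
    Set (Set BinPath) :=
  MeasureTheory.generateSetAlgebra (cylinders ∪ {E ∈ events Sig | E ∈ I ∨ Eᶜ ∈ I})

/-- The set of extensions of `p` from `𝒜₁` to `𝒜₂`: all finitely additive probabilities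
on `𝒜₂` which agree with `p` on `𝒜₁`. -/
def extensions (p : Set BinPath → ℝ) (𝒜₁ 𝒜₂ : Set (Set BinPath)) : Set (Set BinPath → ℝ) :=
  {Q | IsFinAddProb 𝒜₂ Q ∧ ∀ A ∈ 𝒜₁, Q A = p A}

/-! Consider the finitely additive probabilities that are uniform on cylinders and vanish on the
events of the ideal. They form a compact convex set, nonempty because every cylinder carries an
ultrafilter avoiding the ideal. Krein–Milman gives an extreme point `P`.

Uniformity makes `P` strongly nonatomic: lexicographic initial segments form a chain whose mass
grows in steps of at most `2⁻ᵗ`.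

Extremality makes clopen sets dense in the events for `P` (`exists_pathCode_preimage_approx`). For
an event `E`, the charge "`P (F ∩ E)` minus the integral over `F` of the forecast of `E`" has a
limit that is dominated by `P` and zero on clopen sets. Adding it to or subtracting it from `P`
stays in the set, so it is zero, and the forecasts of `E` come close to 0 or 1.

Density yields merging (`blackwellDubins_of_approx`). If `Q ≪ P`, the densities of `Q` on cylinders
are an L²-bounded martingale, hence L¹-Cauchy. So `Q` is nearly given by its time-`t` density on
clopen sets, and by approximation on all events uniformly. A large set of paths with distant
forecasts would give, by gluing witnesses, an event violating this. -/

open scoped MeasureTheory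

/-! ### Cylinders numbered by binary codes -/

/-- The natural number whose binary expansion is given by the first `t` coordinates of a path. -/
def pathCode : ℕ → BinPath → ℕ
  | 0, _ => 0
  | t + 1, ω => 2 * pathCode t ω + (ω t).toNat

/-- The paths whose first `t` coordinates form the binary expansion of `k`. -/
def pathCell (t k : ℕ) : Set BinPath := pathCode t ⁻¹' {k}

theorem mem_pathCell {t k : ℕ} {ω : BinPath} : ω ∈ pathCell t k ↔ pathCode t ω = k := Iff.rfl

theorem pathCode_lt (t : ℕ) (ω : BinPath) : pathCode t ω < 2 ^ t := by
  induction t with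
  | zero => simp [pathCode]
  | succ t ih =>
    have := Bool.toNat_lt (ω t)
    rw [pathCode, pow_succ]
    omega

/-- Each new coordinate is the lowest binary digit, so division by `2 ^ m` forgets the last `m`
coordinates. Thus `k / 2 ^ m` is the ancestor of cell `k`, `m` levels up. -/
theorem pathCode_add_div (t m : ℕ) (ω : BinPath) : pathCode (t + m) ω / 2 ^ m = pathCode t ω := by
  induction m with
  | zero => simp
  | succ m ih =>
    have := Bool.toNat_lt (ω (t + m))
    rw [← add_assoc, pathCode, pow_succ', ← Nat.div_div_eq_div_mul, ← ih]
    congr 1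
    omega

theorem pathCode_eq_iff (t : ℕ) (η ω : BinPath) :
    pathCode t η = pathCode t ω ↔ ∀ i < t, η i = ω i := by
  induction t with
  | zero => simp [pathCode]
  | succ t ih =>
    have h1 := Bool.toNat_lt (ω t)
    have h2 := Bool.toNat_lt (η t)
    rw [Nat.forall_lt_succ_right, ← ih, pathCode, pathCode]
    constructor
    · intro h
      refine ⟨by omega, by cases h3 : η t <;> cases h4 : ω t <;> simp [h3, h4] at h ⊢ <;> omega⟩
    · rintro ⟨h, h'⟩
      rw [h, h']

theorem exists_pathCode_eq (t k : ℕ) (hk : k < 2 ^ t) : ∃ ω, pathCode t ω = k := by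
  induction t generalizing k with
  | zero => exact ⟨fun _ => false, by simp [pathCode] at hk ⊢; omega⟩
  | succ t ih =>
    rw [pow_succ] at hk
    obtain ⟨ω, hω⟩ := ih (k / 2) (by omega)
    refine ⟨Function.update ω t (decide (k % 2 = 1)), ?_⟩
    have h : pathCode t (Function.update ω t (decide (k % 2 = 1))) = pathCode t ω := by
      rw [pathCode_eq_iff]
      intro i hi
      rw [Function.update_of_ne hi.ne]
    rw [pathCode, h, hω, Function.update_self]
    rcases Nat.mod_two_eq_zero_or_one k with h2 | h2 <;> simp [h2] <;> omega

theorem cyl_eq_pathCell (ω : BinPath) (t : ℕ) : cyl ω t = pathCell t (pathCode t ω) := by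
  ext η
  rw [mem_pathCell, pathCode_eq_iff]
  rfl

theorem pathCell_mem_cylinders {t k : ℕ} (hk : k < 2 ^ t) : pathCell t k ∈ cylinders := by
  obtain ⟨ω, rfl⟩ := exists_pathCode_eq t k hk
  exact ⟨ω, t, (cyl_eq_pathCell ω t).symm⟩

theorem pathCell_eq_empty {t k : ℕ} (hk : 2 ^ t ≤ k) : pathCell t k = ∅ := by
  ext ω
  have := pathCode_lt t ω
  simp only [mem_pathCell, mem_empty_iff_false, iff_false]
  omega

theorem pathCell_eq_union (t k : ℕ) :
    pathCell t k = pathCell (t + 1) (2 * k) ∪ pathCell (t + 1) (2 * k + 1) := by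
  ext ω
  have := Bool.toNat_lt (ω t)
  simp only [mem_union, mem_pathCell, pathCode]
  omega

theorem disjoint_pathCell (t : ℕ) {j k : ℕ} (h : j ≠ k) :
    Disjoint (pathCell t j) (pathCell t k) :=
  Disjoint.preimage _ (disjoint_singleton.2 h)

theorem measurableSet_pathCode_preimage {Sig : MeasurableSpace BinPath}
    (hSig : cylinders ⊆ events Sig) (t : ℕ) (S : Set ℕ) :
    MeasurableSet[Sig] (pathCode t ⁻¹' S) := by
  have : @Measurable _ _ Sig _ (pathCode t) := by
    refine @measurable_to_countable' _ _ _ _ Sig _ fun k => ?_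
    rcases lt_or_ge k (2 ^ t) with hk | hk
    · exact hSig (pathCell_mem_cylinders hk)
    · have h := pathCell_eq_empty hk
      rw [pathCell] at h
      rw [h]
      exact @MeasurableSet.empty _ Sig
  exact this (MeasurableSet.of_discrete (s := S))

theorem measurableSet_pathCell {Sig : MeasurableSpace BinPath}
    (hSig : cylinders ⊆ events Sig) (t k : ℕ) : MeasurableSet[Sig] (pathCell t k) :=
  measurableSet_pathCode_preimage hSig t {k}

/-- Sums of step functions against a consistent family of weights do not depend on the level. -/
theorem sum_range_two_pow_refine (w : ℕ → ℕ → ℝ)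
    (hw : ∀ t k, k < 2 ^ t → w t k = w (t + 1) (2 * k) + w (t + 1) (2 * k + 1)) (t m : ℕ)
    (a : ℕ → ℝ) :
    ∑ k ∈ Finset.range (2 ^ (t + m)), a (k / 2 ^ m) * w (t + m) k =
      ∑ k ∈ Finset.range (2 ^ t), a k * w t k := by
  have split : ∀ (n : ℕ) (f : ℕ → ℝ), ∑ k ∈ Finset.range (2 * n), f k =
      ∑ k ∈ Finset.range n, (f (2 * k) + f (2 * k + 1)) := by
    intro n f
    induction n with
    | zero => simp
    | succ n ih =>
      rw [Nat.mul_succ, Finset.sum_range_succ, Finset.sum_range_succ, ih, Finset.sum_range_succ,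
        add_assoc]
  induction m with
  | zero => simp
  | succ m ih =>
    rw [← ih, ← add_assoc, pow_succ' 2 (t + m), split]
    refine Finset.sum_congr rfl fun k hk => ?_
    rw [hw (t + m) k (Finset.mem_range.1 hk), pow_succ', ← Nat.div_div_eq_div_mul,
      ← Nat.div_div_eq_div_mul, show 2 * k / 2 = k by omega, show (2 * k + 1) / 2 = k by omega]
    ring

/-! ### Finite additivity over cells -/

namespace IsFinAddProb

variable {Sig : MeasurableSpace BinPath} {P : Set BinPath → ℝ}

theorem apply_nonneg (hP : IsFinAddProb (events Sig) P) (E : Set BinPath) : 0 ≤ P E := by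
  by_cases hE : E ∈ events Sig
  · exact hP.nonneg E hE
  · exact (hP.eq_zero_of_notMem E hE).ge

theorem apply_empty (hP : IsFinAddProb (events Sig) P) : P ∅ = 0 := by
  have h : (∅ : Set BinPath) ∈ events Sig := @MeasurableSet.empty _ Sig
  have := hP.union_eq ∅ h ∅ h (disjoint_empty _)
  rw [union_empty] at this
  linarith

theorem inter_add_diff (hP : IsFinAddProb (events Sig) P) {E F : Set BinPath}
    (hE : MeasurableSet[Sig] E) (hF : MeasurableSet[Sig] F) : P (E ∩ F) + P (E \ F) = P E := by
  rw [← hP.union_eq _ (hE.inter hF) _ (hE.diff hF) disjoint_sdiff_inter.symm, inter_union_sdiff]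

theorem mono (hP : IsFinAddProb (events Sig) P) {E F : Set BinPath}
    (hE : MeasurableSet[Sig] E) (hF : MeasurableSet[Sig] F) (h : E ⊆ F) : P E ≤ P F := by
  rw [← hP.inter_add_diff hF hE, inter_eq_self_of_subset_right h]
  linarith [hP.apply_nonneg (F \ E)]

theorem le_one (hP : IsFinAddProb (events Sig) P) (E : Set BinPath) : P E ≤ 1 := by
  by_cases hE : E ∈ events Sig
  · exact hP.univ_eq_one ▸ hP.mono hE (@MeasurableSet.univ _ Sig) (subset_univ E)
  · exact (hP.eq_zero_of_notMem E hE).trans_le zero_le_one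

theorem sum_inter_pathCell (hSig : cylinders ⊆ events Sig) (hP : IsFinAddProb (events Sig) P)
    {E : Set BinPath} (hE : MeasurableSet[Sig] E) (t : ℕ) :
    P E = ∑ k ∈ Finset.range (2 ^ t), P (E ∩ pathCell t k) := by
  have key : ∀ n, P (E ∩ pathCode t ⁻¹' Iio n) = ∑ k ∈ Finset.range n, P (E ∩ pathCell t k) := by
    intro n
    induction n with
    | zero => simpa using hP.apply_empty
    | succ n ih =>
      have h : E ∩ pathCode t ⁻¹' Iio (n + 1) =
          (E ∩ pathCode t ⁻¹' Iio n) ∪ (E ∩ pathCell t n) := by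
        ext ω
        simp only [mem_inter_iff, mem_preimage, mem_Iio, mem_union, mem_pathCell]
        grind
      rw [h, hP.union_eq _ (hE.inter (measurableSet_pathCode_preimage hSig t _)) _
        (hE.inter (measurableSet_pathCell hSig t n)), ih, Finset.sum_range_succ]
      rw [disjoint_left]
      rintro ω ⟨-, h1⟩ ⟨-, h2⟩
      rw [mem_pathCell] at h2
      rw [mem_preimage, h2] at h1
      exact lt_irrefl n h1
  rw [← key]
  congr 1
  ext ω
  simp [pathCode_lt]

theorem inter_pathCell_split (hSig : cylinders ⊆ events Sig) (hP : IsFinAddProb (events Sig) P)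
    {E : Set BinPath} (hE : MeasurableSet[Sig] E) (t k : ℕ) :
    P (E ∩ pathCell t k) =
      P (E ∩ pathCell (t + 1) (2 * k)) + P (E ∩ pathCell (t + 1) (2 * k + 1)) := by
  rw [pathCell_eq_union, inter_union_distrib_left, hP.union_eq]
  · exact hE.inter (measurableSet_pathCell hSig _ _)
  · exact hE.inter (measurableSet_pathCell hSig _ _)
  · exact (disjoint_pathCell _ (by omega)).mono inter_subset_right inter_subset_right

theorem pathCell_split (hSig : cylinders ⊆ events Sig) (hP : IsFinAddProb (events Sig) P)
    (t k : ℕ) :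
    P (pathCell t k) = P (pathCell (t + 1) (2 * k)) + P (pathCell (t + 1) (2 * k + 1)) := by
  simpa using hP.inter_pathCell_split hSig (@MeasurableSet.univ _ Sig) t k

end IsFinAddProb

theorem preimage_inter_pathCell_of_mem {t m k : ℕ} {S : Set ℕ} (h : k / 2 ^ m ∈ S) :
    pathCode t ⁻¹' S ∩ pathCell (t + m) k = pathCell (t + m) k := by
  refine inter_eq_self_of_subset_right fun ω hω => ?_
  rw [mem_pathCell] at hω
  rwa [mem_preimage, ← pathCode_add_div t m, hω]

theorem preimage_inter_pathCell_of_notMem {t m k : ℕ} {S : Set ℕ} (h : k / 2 ^ m ∉ S) :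
    pathCode t ⁻¹' S ∩ pathCell (t + m) k = ∅ := by
  refine eq_empty_of_forall_notMem ?_
  rintro ω ⟨h1, h2⟩
  rw [mem_pathCell] at h2
  rw [mem_preimage, ← pathCode_add_div t m, h2] at h1
  exact h h1

/-! ### Ultrafilter limits and the compact convex set -/

/-- A bounded real sequence converges along the hyperfilter. -/
theorem exists_tendsto_hyperfilter {u : ℕ → ℝ} {a b : ℝ} (hu : ∀ n, u n ∈ Icc a b) :
    ∃ x ∈ Icc a b, Tendsto u (hyperfilter ℕ) (𝓝 x) := by
  obtain ⟨x, hx, h⟩ := (isCompact_Icc (a := a) (b := b)).ultrafilter_le_nhds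
    ((hyperfilter ℕ).map u) (by
      rw [le_principal_iff]
      exact mem_map.2 (univ_mem' hu))
  exact ⟨x, hx, h⟩

theorem eventually_hyperfilter_ge (s : ℕ) : ∀ᶠ t in (hyperfilter ℕ : Filter ℕ), s ≤ t :=
  Nat.hyperfilter_le_atTop (eventually_ge_atTop s)

/-- The finitely additive probabilities on the events which give each cylinder of length `t` the
probability `2⁻ᵗ` and which vanish on the events in `I`. -/
def uniformNullExtensions (Sig : MeasurableSpace BinPath) (I : Set (Set BinPath)) :
    Set (Set BinPath → ℝ) :=
  {P | IsFinAddProb (events Sig) P ∧ (∀ t k, k < 2 ^ t → P (pathCell t k) = (2 ^ t)⁻¹) ∧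
    ∀ E ∈ events Sig, E ∈ I → P E = 0}

/-! ### Strong nonatomicity -/

/-- At the common level `t + s`, both sets are initial segments of the same finite order. -/
theorem pathCode_preimage_Iio_total (t k s l : ℕ) :
    pathCode t ⁻¹' Iio k ⊆ pathCode s ⁻¹' Iio l ∨
      pathCode s ⁻¹' Iio l ⊆ pathCode t ⁻¹' Iio k := by
  have key : ∀ t k s, pathCode t ⁻¹' Iio k = pathCode (t + s) ⁻¹' Iio (k * 2 ^ s) := by
    intro t k s
    ext ω
    rw [mem_preimage, mem_preimage, mem_Iio, mem_Iio, ← pathCode_add_div t s,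
      Nat.div_lt_iff_lt_mul (by positivity)]
  rw [key t k s, key s l t, add_comm s t]
  rcases le_total (k * 2 ^ s) (l * 2 ^ t) with h | h
  · exact Or.inl (preimage_mono (Iio_subset_Iio h))
  · exact Or.inr (preimage_mono (Iio_subset_Iio h))

/-- `P` need not be continuous along increasing unions, so the mass of the union `T` is found by
squeezing `T`, at every level, between two initial segments that differ by one cell. -/
theorem stronglyNonatomic_of_pathCell {Sig : MeasurableSpace BinPath}
    (hSig : cylinders ⊆ events Sig) {P : Set BinPath → ℝ} (hP : IsFinAddProb (events Sig) P)
    (hcell : ∀ t k, k < 2 ^ t → P (pathCell t k) = (2 ^ t)⁻¹) : StronglyNonatomic Sig P := by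
  intro E hE α hα
  set c := α * P E with hc
  have hcE : c ≤ P E := mul_le_of_le_one_left (hP.apply_nonneg E) hα.2
  have hc0 : 0 ≤ c := mul_nonneg hα.1 (hP.apply_nonneg E)
  rcases hcE.eq_or_lt with hEc | hEc
  · exact ⟨E, hE, Subset.rfl, hEc.symm⟩
  let A : ℕ × ℕ → Set BinPath := fun p => pathCode p.1 ⁻¹' Iio p.2
  have hA : ∀ p, MeasurableSet[Sig] (A p) := fun p => measurableSet_pathCode_preimage hSig _ _
  have hE' : MeasurableSet[Sig] E := hE
  let B : Set (ℕ × ℕ) := {p | P (E ∩ A p) ≤ c}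
  let T : Set BinPath := ⋃ p ∈ B, A p
  -- The family of segments is countable, so only the `σ`-algebra structure of the events is used.
  have hT : MeasurableSet[Sig] T := MeasurableSet.biUnion B.to_countable fun p _ => hA p
  refine ⟨E ∩ T, hE'.inter hT, inter_subset_left, ?_⟩
  have key : ∀ t : ℕ, |P (E ∩ T) - c| ≤ (2 ^ t)⁻¹ := by
    intro t
    have hex : ∃ k, c < P (E ∩ A (t, k)) := by
      refine ⟨2 ^ t, ?_⟩
      have : A (t, 2 ^ t) = univ := eq_univ_of_forall fun ω => pathCode_lt t ω
      rwa [this, inter_univ]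
    classical
    obtain ⟨k, hk, hmin⟩ : ∃ k, c < P (E ∩ A (t, k)) ∧ ∀ j < k, P (E ∩ A (t, j)) ≤ c :=
      ⟨Nat.find hex, Nat.find_spec hex, fun j hj => not_lt.1 (Nat.find_min hex hj)⟩
    obtain ⟨j, rfl⟩ : ∃ j, k = j + 1 := by
      refine Nat.exists_eq_succ_of_ne_zero ?_
      rintro rfl
      have : A (t, 0) = ∅ := by simp [A]
      rw [this, inter_empty, hP.apply_empty] at hk
      exact hk.not_ge hc0
    have hj : P (E ∩ A (t, j)) ≤ c := hmin j j.lt_succ_self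
    have hstep : P (E ∩ A (t, j + 1)) ≤ P (E ∩ A (t, j)) + (2 ^ t)⁻¹ := by
      have hsub : (E ∩ A (t, j + 1)) \ A (t, j) ⊆ pathCell t j := by
        rintro ω ⟨⟨-, h1⟩, h2⟩
        simp only [A, mem_preimage, mem_Iio] at h1 h2
        rw [mem_pathCell]
        omega
      have hle : P ((E ∩ A (t, j + 1)) \ A (t, j)) ≤ (2 ^ t)⁻¹ := by
        refine (hP.mono ((hE'.inter (hA _)).diff (hA _)) (measurableSet_pathCell hSig t j)
          hsub).trans ?_
        rcases lt_or_ge j (2 ^ t) with h | h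
        · exact (hcell t j h).le
        · rw [pathCell_eq_empty h, hP.apply_empty]
          positivity
      have hle' := hP.mono ((hE'.inter (hA (t, j + 1))).inter (hA (t, j))) (hE'.inter (hA (t, j)))
        (inter_subset_inter_left _ inter_subset_left)
      linarith [hP.inter_add_diff (hE'.inter (hA (t, j + 1))) (hA (t, j))]
    have hlow : P (E ∩ A (t, j)) ≤ P (E ∩ T) :=
      hP.mono (hE'.inter (hA _)) (hE'.inter hT)
        (inter_subset_inter_right _ (subset_biUnion_of_mem (u := A) (show (t, j) ∈ B from hj)))
    -- Segment `j + 1` has mass above `c` in `E`, so by the chain property it contains every segment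
    -- indexed by `B`.
    have hup : P (E ∩ T) ≤ P (E ∩ A (t, j + 1)) := by
      refine hP.mono (hE'.inter hT) (hE'.inter (hA _)) (inter_subset_inter_right _ ?_)
      refine iUnion₂_subset fun q hq => ?_
      rcases pathCode_preimage_Iio_total q.1 q.2 t (j + 1) with h | h
      · exact h
      · exact absurd (hk.trans_le ((hP.mono (hE'.inter (hA _)) (hE'.inter (hA q))
          (inter_subset_inter_right _ h)).trans hq)) (lt_irrefl c)
    rw [abs_le]
    constructor <;> linarith
  refine eq_of_abs_sub_nonpos (le_of_forall_pos_lt_add fun ε hε => ?_)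
  obtain ⟨n, hn⟩ := exists_pow_lt_of_lt_one hε (show (2⁻¹ : ℝ) < 1 by norm_num)
  rw [inv_pow] at hn
  linarith [key n]

/-! ### Nonemptiness and compactness -/

theorem exists_ultrafilter_of_strictlyProperIdeal {I : Set (Set BinPath)}
    (hI : IsStrictlyProperIdeal I) {C : Set BinPath} (hC : C ∈ cylinders) :
    ∃ U : Ultrafilter BinPath, C ∈ U ∧ ∀ X ∈ I, X ∉ U := by
  -- The disjunct `X ∩ C = ∅` is needed because `I` may be empty and then does not contain `∅`. The
  -- filter is proper since `C ∉ I`.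
  let F : Filter BinPath := Filter.comk (fun X => X ∩ C = ∅ ∨ X ∩ C ∈ I)
    (Or.inl (empty_inter C))
    (by
      rintro t (h | h) s hst
      · exact Or.inl (subset_empty_iff.1 (h ▸ inter_subset_inter_left C hst))
      · exact Or.inr (hI.mem_of_subset _ h _ (inter_subset_inter_left C hst)))
    (by
      rintro s (hs | hs) t (ht | ht) <;> rw [union_inter_distrib_right]
      · exact Or.inl (by rw [hs, ht, union_empty])
      · exact Or.inr (by rwa [hs, empty_union])
      · exact Or.inr (by rwa [ht, union_empty])
      · exact Or.inr (hI.union_mem _ hs _ ht))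
  have hF : F.NeBot := by
    rw [neBot_iff]
    intro h
    have : ∅ ∈ F := by rw [h]; exact mem_bot
    rw [mem_comk, compl_empty, univ_inter] at this
    rcases this with h | h
    · obtain ⟨ω, t, rfl⟩ := hC
      exact notMem_empty ω (h ▸ PiNat.self_mem_cylinder ω t)
    · exact hI.cylinder_notMem C hC h
  refine ⟨Ultrafilter.of F, Ultrafilter.of_le F ?_, fun X hX hXU => ?_⟩
  · rw [mem_comk]
    exact Or.inl (compl_inter_self C)
  · have : Xᶜ ∈ F := by
      rw [mem_comk, compl_compl]
      exact Or.inr (hI.mem_of_subset X hX _ inter_subset_left)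
    exact (Ultrafilter.compl_mem_iff_notMem.1 (Ultrafilter.of_le F this)) hXU

theorem uniformNullExtensions_nonempty {Sig : MeasurableSpace BinPath}
    (hSig : cylinders ⊆ events Sig) {I : Set (Set BinPath)} (hI : IsStrictlyProperIdeal I) :
    (uniformNullExtensions Sig I).Nonempty := by
  classical
  have hU : ∀ t k, ∃ U : Ultrafilter BinPath, k < 2 ^ t → pathCell t k ∈ U ∧ ∀ X ∈ I, X ∉ U := by
    intro t k
    by_cases hk : k < 2 ^ t
    · obtain ⟨U, h⟩ := exists_ultrafilter_of_strictlyProperIdeal hI (pathCell_mem_cylinders hk)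
      exact ⟨U, fun _ => h⟩
    · exact ⟨pure default, fun h => absurd h hk⟩
  choose U hU using hU
  -- Mass `2⁻ᵗ` on one ultrafilter in each cell of level `t`. This is uniform only up to level `t`;
  -- the limit over `t` is uniform at all levels.
  let R : ℕ → Set BinPath → ℝ := fun t E => if E ∈ events Sig then
    ∑ k ∈ Finset.range (2 ^ t), (if E ∈ U t k then 1 else 0) * ((2 : ℝ) ^ t)⁻¹ else 0
  have hRprob : ∀ t, IsFinAddProb (events Sig) (R t) := by
    intro t
    refine ⟨fun E hE => ?_, ?_, fun E hE F hF hEF => ?_, fun E hE => if_neg hE⟩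
    · simp only [R, if_pos hE]
      exact Finset.sum_nonneg fun k _ => by positivity
    · simp only [R, if_pos (show univ ∈ events Sig from @MeasurableSet.univ _ Sig)]
      simp [show ∀ k, univ ∈ U t k from fun k => Filter.univ_mem]
    · have hEF' : E ∪ F ∈ events Sig := MeasurableSet.union (m := Sig) hE hF
      simp only [R, if_pos hE, if_pos hF, if_pos hEF']
      rw [← Finset.sum_add_distrib]
      refine Finset.sum_congr rfl fun k _ => ?_
      rw [← add_mul]
      congr 1
      by_cases h1 : E ∈ U t k <;> by_cases h2 : F ∈ U t k <;>
        simp only [Ultrafilter.union_mem_iff, h1, h2, if_true, if_false, or_true, true_or,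
          or_self, add_zero, zero_add]
      have := Filter.inter_mem h1 h2
      rw [hEF.inter_eq] at this
      exact (Ultrafilter.empty_notMem this).elim
  have hRcell : ∀ s k t, k < 2 ^ s → s ≤ t → R t (pathCell s k) = (2 ^ s)⁻¹ := by
    intro s j t hj hst
    obtain ⟨m, rfl⟩ := Nat.exists_eq_add_of_le hst
    simp only [R, if_pos (show pathCell s j ∈ events Sig from measurableSet_pathCell hSig s j)]
    have := sum_range_two_pow_refine (fun t _ => ((2 : ℝ) ^ t)⁻¹)
      (fun t k _ => by rw [pow_succ]; field_simp; norm_num) s m (fun k => if k = j then 1 else 0)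
    simp only [ite_mul, one_mul, zero_mul, Finset.sum_ite_eq', Finset.mem_range, hj, if_true]
      at this ⊢
    rw [← this]
    refine Finset.sum_congr rfl fun k hk => ?_
    have hk' := (hU (s + m) k (Finset.mem_range.1 hk)).1
    refine if_congr ?_ rfl rfl
    constructor
    · intro h
      have h2 := Filter.inter_mem h hk'
      by_contra h3
      rw [pathCell, preimage_inter_pathCell_of_notMem h3] at h2
      exact Ultrafilter.empty_notMem h2
    · intro h
      rw [← preimage_inter_pathCell_of_mem (S := {j}) h] at hk'
      exact mem_of_superset hk' inter_subset_left
  have hRI : ∀ t, ∀ E ∈ events Sig, E ∈ I → R t E = 0 := by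
    intro t E hE hEI
    simp only [R, if_pos hE]
    refine Finset.sum_eq_zero fun k hk => ?_
    rw [if_neg ((hU t k (Finset.mem_range.1 hk)).2 E hEI), zero_mul]
  have hlim : ∀ E, ∃ x ∈ Icc (0 : ℝ) 1, Tendsto (fun t => R t E) (hyperfilter ℕ) (𝓝 x) :=
    fun E => exists_tendsto_hyperfilter fun t => ⟨(hRprob t).apply_nonneg E, (hRprob t).le_one E⟩
  choose P hP01 hP using hlim
  refine ⟨P, ⟨fun E _ => (hP01 E).1, ?_, fun E hE F hF hEF => ?_, fun E hE => ?_⟩,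
    fun s k hk => ?_, fun E hE hEI => ?_⟩
  · exact tendsto_nhds_unique (hP univ) (by simp only [(hRprob _).univ_eq_one, tendsto_const_nhds])
  · refine tendsto_nhds_unique (hP _) ?_
    simp only [fun t => (hRprob t).union_eq E hE F hF hEF]
    exact (hP E).add (hP F)
  · refine tendsto_nhds_unique (hP _) ?_
    simp only [fun t => (hRprob t).eq_zero_of_notMem E hE, tendsto_const_nhds]
  · refine tendsto_nhds_unique (hP _) (tendsto_const_nhds.congr' ?_)
    filter_upwards [eventually_hyperfilter_ge s] with t ht
    exact (hRcell s k t hk ht).symm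
  · refine tendsto_nhds_unique (hP _) ?_
    simp only [fun t => hRI t E hE hEI, tendsto_const_nhds]

/-- A subset of the compact cube with factors `[0, 1]`, cut out by closed conditions on finitely
many coordinates each. -/
theorem isCompact_uniformNullExtensions (Sig : MeasurableSpace BinPath) (I : Set (Set BinPath)) :
    IsCompact (uniformNullExtensions Sig I) := by
  have hcpt : IsCompact (univ.pi fun _ : Set BinPath => Icc (0 : ℝ) 1) :=
    isCompact_univ_pi fun _ => isCompact_Icc
  refine hcpt.of_isClosed_subset ?_ fun P hP E _ => ⟨hP.1.apply_nonneg E, hP.1.le_one E⟩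
  have : uniformNullExtensions Sig I =
      ({P | ∀ E ∈ events Sig, 0 ≤ P E} ∩ {P | P univ = 1} ∩
      {P | ∀ E ∈ events Sig, ∀ F ∈ events Sig, Disjoint E F → P (E ∪ F) = P E + P F} ∩
      {P | ∀ E, E ∉ events Sig → P E = 0}) ∩
      ({P | ∀ t k, k < 2 ^ t → P (pathCell t k) = (2 ^ t)⁻¹} ∩
      {P | ∀ E ∈ events Sig, E ∈ I → P E = 0}) := by
    ext P
    constructor
    · rintro ⟨⟨h1, h2, h3, h4⟩, h5, h6⟩
      exact ⟨⟨⟨⟨h1, h2⟩, h3⟩, h4⟩, h5, h6⟩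
    · rintro ⟨⟨⟨⟨h1, h2⟩, h3⟩, h4⟩, h5, h6⟩
      exact ⟨⟨h1, h2, h3, h4⟩, h5, h6⟩
  rw [this]
  simp only [ofPred_forall]
  refine (((IsClosed.inter ?_ ?_).inter ?_).inter ?_).inter (IsClosed.inter ?_ ?_)
  · exact isClosed_biInter fun E _ => isClosed_le continuous_const (continuous_apply E)
  · exact isClosed_eq (continuous_apply _) continuous_const
  · exact isClosed_biInter fun E _ => isClosed_biInter fun F _ => isClosed_iInter fun _ =>
      isClosed_eq (continuous_apply _) ((continuous_apply E).add (continuous_apply F))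
  · exact isClosed_iInter fun E => isClosed_iInter fun _ =>
      isClosed_eq (continuous_apply _) continuous_const
  · exact isClosed_iInter fun t => isClosed_iInter fun k => isClosed_iInter fun _ =>
      isClosed_eq (continuous_apply _) continuous_const
  · exact isClosed_biInter fun E _ => isClosed_iInter fun _ =>
      isClosed_eq (continuous_apply _) continuous_const

/-! ### Approximation by clopen sets at extreme points -/

/-- Events are approximated by finite unions of cylinders under an extreme point of
`uniformNullExtensions`. -/
theorem exists_pathCode_preimage_approx {Sig : MeasurableSpace BinPath}
    (hSig : cylinders ⊆ events Sig) {I : Set (Set BinPath)} {P : Set BinPath → ℝ}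
    (hP : P ∈ (uniformNullExtensions Sig I).extremePoints ℝ) {E : Set BinPath}
    (hE : MeasurableSet[Sig] E) {ε : ℝ} (hε : 0 < ε) :
    ∃ (t : ℕ) (S : Set ℕ), P (E \ pathCode t ⁻¹' S) + P (pathCode t ⁻¹' S \ E) < ε := by
  classical
  obtain ⟨⟨hprob, hcell, hnull⟩, hext⟩ := hP
  have hC : ∀ t k, MeasurableSet[Sig] (pathCell t k) := measurableSet_pathCell hSig
  let f : ℕ → ℕ → ℝ := fun t k => P (E ∩ pathCell t k) / P (pathCell t k)
  have hle : ∀ t k, P (E ∩ pathCell t k) ≤ P (pathCell t k) := fun t k =>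
    hprob.mono (hE.inter (hC t k)) (hC t k) inter_subset_right
  have hf0 : ∀ t k, 0 ≤ f t k := fun t k =>
    div_nonneg (hprob.apply_nonneg _) (hprob.apply_nonneg _)
  have hf1 : ∀ t k, f t k ≤ 1 := fun t k => div_le_one_of_le₀ (hle t k) (hprob.apply_nonneg _)
  have hfm : ∀ t k, f t k * P (pathCell t k) = P (E ∩ pathCell t k) := by
    intro t k
    rcases eq_or_ne (P (pathCell t k)) 0 with h | h
    · rw [h, mul_zero]
      exact le_antisymm (hprob.apply_nonneg _) ((hle t k).trans h.le)
    · exact div_mul_cancel₀ _ h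
  have hdiff : ∀ t k, P (pathCell t k \ E) = (1 - f t k) * P (pathCell t k) := by
    intro t k
    have := hprob.inter_add_diff (hC t k) hE
    rw [inter_comm, ← hfm] at this
    linarith
  -- `R t F` equals `P (F ∩ E)` minus the integral over `F` of the forecast `f t` of `E`. The split
  -- form shows that it lies between `-P F` and `P F`.
  let R : ℕ → Set BinPath → ℝ := fun t F => if F ∈ events Sig then
    ∑ k ∈ Finset.range (2 ^ t), ((1 - f t k) * P (F ∩ E ∩ pathCell t k) -
      f t k * P (F \ E ∩ pathCell t k)) else 0
  have hRadd : ∀ t, ∀ F ∈ events Sig, ∀ G ∈ events Sig, Disjoint F G →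
      R t (F ∪ G) = R t F + R t G := by
    intro t F hF G hG hFG
    have hFG' : F ∪ G ∈ events Sig := MeasurableSet.union (m := Sig) hF hG
    replace hF : MeasurableSet[Sig] F := hF
    replace hG : MeasurableSet[Sig] G := hG
    simp only [R, if_pos hFG', if_pos (show F ∈ events Sig from hF),
      if_pos (show G ∈ events Sig from hG)]
    rw [← Finset.sum_add_distrib]
    refine Finset.sum_congr rfl fun k _ => ?_
    rw [union_inter_distrib_right, union_inter_distrib_right, union_sdiff_distrib,
      union_inter_distrib_right,
      hprob.union_eq _ ((hF.inter hE).inter (hC t k)) _ ((hG.inter hE).inter (hC t k))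
        (hFG.mono (inter_subset_left.trans inter_subset_left)
          (inter_subset_left.trans inter_subset_left)),
      hprob.union_eq _ ((hF.diff hE).inter (hC t k)) _ ((hG.diff hE).inter (hC t k))
        (hFG.mono (inter_subset_left.trans sdiff_subset) (inter_subset_left.trans sdiff_subset))]
    ring
  have hRabs : ∀ F t, R t F ∈ Icc (-P F) (P F) := by
    intro F t
    by_cases hF : F ∈ events Sig
    · simp only [R, if_pos hF]
      replace hF : MeasurableSet[Sig] F := hF
      have h := hprob.inter_add_diff hF hE
      rw [hprob.sum_inter_pathCell hSig (hF.inter hE) t,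
        hprob.sum_inter_pathCell hSig (hF.diff hE) t, ← Finset.sum_add_distrib] at h
      rw [← h, ← Finset.sum_neg_distrib]
      constructor <;> refine Finset.sum_le_sum fun k _ => ?_
      all_goals
        have h1 := mul_nonneg (hf0 t k) (hprob.apply_nonneg (F ∩ E ∩ pathCell t k))
        have h2 := mul_nonneg (hf0 t k) (hprob.apply_nonneg (F \ E ∩ pathCell t k))
        have h3 := mul_nonneg (sub_nonneg.2 (hf1 t k))
          (hprob.apply_nonneg (F ∩ E ∩ pathCell t k))
        have h4 := mul_nonneg (sub_nonneg.2 (hf1 t k))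
          (hprob.apply_nonneg (F \ E ∩ pathCell t k))
        have h5 := hprob.apply_nonneg (F ∩ E ∩ pathCell t k)
        have h6 := hprob.apply_nonneg (F \ E ∩ pathCell t k)
        linarith
    · simp only [R, if_neg hF, hprob.eq_zero_of_notMem F hF, neg_zero, Icc_self, mem_singleton_iff]
  have hRclopen : ∀ s (S : Set ℕ) t, s ≤ t → R t (pathCode s ⁻¹' S) = 0 := by
    intro s S t hst
    obtain ⟨m, rfl⟩ := Nat.exists_eq_add_of_le hst
    simp only [R, if_pos (show pathCode s ⁻¹' S ∈ events Sig from
      measurableSet_pathCode_preimage hSig s S)]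
    refine Finset.sum_eq_zero fun k _ => ?_
    rw [inter_right_comm, sdiff_inter_right_comm]
    by_cases hk : k / 2 ^ m ∈ S
    · rw [preimage_inter_pathCell_of_mem hk, inter_comm, ← hfm, hdiff]
      ring
    · rw [preimage_inter_pathCell_of_notMem hk, empty_inter, empty_sdiff, hprob.apply_empty]
      ring
  choose Q hQabs hQ using fun F => exists_tendsto_hyperfilter (hRabs F)
  have hQclopen : ∀ s (S : Set ℕ), Q (pathCode s ⁻¹' S) = 0 := by
    intro s S
    refine tendsto_nhds_unique (hQ _) (tendsto_const_nhds.congr' ?_)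
    filter_upwards [eventually_hyperfilter_ge s] with t ht
    exact (hRclopen s S t ht).symm
  have hQadd : ∀ F ∈ events Sig, ∀ G ∈ events Sig, Disjoint F G → Q (F ∪ G) = Q F + Q G := by
    intro F hF G hG hFG
    refine tendsto_nhds_unique (hQ _) ?_
    simp only [fun t => hRadd t F hF G hG hFG]
    exact (hQ F).add (hQ G)
  have hQzero : ∀ F, P F = 0 → Q F = 0 := by
    intro F hF
    have := hQabs F
    rw [hF, neg_zero, Icc_self] at this
    exact this
  have hmem : ∀ σ : ℝ, |σ| = 1 → (fun F => P F + σ * Q F) ∈ uniformNullExtensions Sig I := by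
    intro σ hσ
    refine ⟨⟨fun F _ => ?_, ?_, fun F hF G hG hFG => ?_, fun F hF => ?_⟩, fun t k hk => ?_,
      fun F hF hFI => ?_⟩
    · have h : |σ * Q F| ≤ P F := by
        rw [abs_mul, hσ, one_mul]
        exact abs_le.2 (hQabs F)
      linarith [(abs_le.1 h).1]
    · have := hQclopen 0 univ
      rw [preimage_univ] at this
      simp only [this, hprob.univ_eq_one, mul_zero, add_zero]
    · simp only [hQadd F hF G hG hFG, hprob.union_eq F hF G hG hFG]
      ring
    · have := hprob.eq_zero_of_notMem F hF
      simp only [this, hQzero F this, mul_zero, add_zero]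
    · have : Q (pathCell t k) = 0 := hQclopen t {k}
      simp only [this, hcell t k hk, mul_zero, add_zero]
    · have := hnull F hF hFI
      simp only [this, hQzero F this, mul_zero, add_zero]
  -- `P` is the midpoint of `P + Q` and `P - Q`.
  have hQE : Q E = 0 := by
    have := hext (hmem 1 abs_one) (hmem (-1) (by simp))
      ⟨1 / 2, 1 / 2, by norm_num, by norm_num, by norm_num, by
        funext F
        simp only [Pi.add_apply, Pi.smul_apply, smul_eq_mul]
        ring⟩
    have := congrFun this E
    simpa using this
  obtain ⟨t, ht⟩ : ∃ t, R t E < ε / 2 := by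
    have := hQ E
    rw [hQE] at this
    exact (this.eventually (gt_mem_nhds (half_pos hε))).exists
  -- Now `R t E` is the sum of `f (1 - f) P C` over the cells `C`.
  simp only [R, if_pos (show E ∈ events Sig from hE), inter_self, sdiff_self,
    empty_inter, hprob.apply_empty, mul_zero, sub_zero] at ht
  refine ⟨t, {k | 1 / 2 ≤ f t k}, ?_⟩
  set S : Set ℕ := {k | 1 / 2 ≤ f t k} with hS
  have hmS := measurableSet_pathCode_preimage hSig t S
  rw [hprob.sum_inter_pathCell hSig (hE.diff hmS) t,
    hprob.sum_inter_pathCell hSig (hmS.diff hE) t, ← Finset.sum_add_distrib]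
  -- Rounding `f` to 0 or 1 costs `min f (1 - f) ≤ 2 f (1 - f)` on each cell.
  refine lt_of_le_of_lt (b := ∑ k ∈ Finset.range (2 ^ t),
    2 * ((1 - f t k) * P (E ∩ pathCell t k))) (Finset.sum_le_sum fun k _ => ?_) ?_
  · have hp := hprob.apply_nonneg (pathCell t k)
    have h1 := hf0 t k
    have h2 := hf1 t k
    rw [sdiff_inter_right_comm, sdiff_inter_right_comm]
    by_cases hk : k ∈ S
    · have hk' := preimage_inter_pathCell_of_mem (t := t) (m := 0) (k := k) (by simpa using hk)
      rw [add_zero] at hk'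
      have h3 : (E ∩ pathCell t k) \ pathCode t ⁻¹' S = ∅ := by
        rw [sdiff_eq_empty, ← hk']
        exact inter_subset_right.trans inter_subset_left
      rw [hk', h3, hprob.apply_empty, hdiff, ← hfm]
      have hk2 : 1 / 2 ≤ f t k := hk
      nlinarith [mul_nonneg (mul_nonneg (sub_nonneg.2 h2) hp) (sub_nonneg.2 hk2)]
    · have hk' := preimage_inter_pathCell_of_notMem (t := t) (m := 0) (k := k) (by simpa using hk)
      rw [add_zero] at hk'
      have h3 : (E ∩ pathCell t k) \ pathCode t ⁻¹' S = E ∩ pathCell t k := by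
        rw [sdiff_eq_left]
        exact (disjoint_iff_inter_eq_empty.2 hk').symm.mono_left inter_subset_right
      rw [hk', h3, empty_sdiff, hprob.apply_empty, ← hfm]
      have hk2 : f t k < 1 / 2 := not_le.1 hk
      nlinarith [mul_nonneg (mul_nonneg h1 hp) (sub_nonneg.2 hk2.le)]
  · rw [← Finset.mul_sum]
    linarith

/-! ### Merging from clopen approximation -/

theorem AbsCont.exists_forall_lt {Sig : MeasurableSpace BinPath} {P Q : Set BinPath → ℝ}
    (hP : IsFinAddProb (events Sig) P) (hQP : AbsCont Sig Q P) {ε : ℝ} (hε : 0 < ε) :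
    ∃ δ > 0, ∀ E ∈ events Sig, P E < δ → Q E < ε := by
  by_contra! h
  choose E hE hPE hQE using fun n : ℕ => h (1 / ((n : ℝ) + 1)) (by positivity)
  have hlim := hQP E hE (squeeze_zero (fun n => hP.apply_nonneg _) (fun n => (hPE n).le)
    tendsto_one_div_add_atTop_nhds_zero_nat)
  exact hε.not_ge (ge_of_tendsto' hlim hQE)

/-- The density of `Q` with respect to `P + Q` on the cylinders of length `t`. -/
noncomputable def cellDensity (P Q : Set BinPath → ℝ) (t k : ℕ) : ℝ :=
  Q (pathCell t k) / (P (pathCell t k) + Q (pathCell t k))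

/-- The defect `Q F - ∫_F h d(P + Q)`, where `h` is the density of `Q` with respect to `P + Q`
on the cylinders of length `t`. -/
noncomputable def densityDefect (P Q : Set BinPath → ℝ) (t : ℕ) (F : Set BinPath) : ℝ :=
  ∑ k ∈ Finset.range (2 ^ t), ((1 - cellDensity P Q t k) * Q (F ∩ pathCell t k) -
    cellDensity P Q t k * P (F ∩ pathCell t k))

section

variable {Sig : MeasurableSpace BinPath} {P Q : Set BinPath → ℝ}

theorem cellDensity_nonneg (hP : IsFinAddProb (events Sig) P) (hQ : IsFinAddProb (events Sig) Q)
    (t k : ℕ) : 0 ≤ cellDensity P Q t k :=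
  div_nonneg (hQ.apply_nonneg _) (add_nonneg (hP.apply_nonneg _) (hQ.apply_nonneg _))

theorem cellDensity_le_one (hP : IsFinAddProb (events Sig) P) (hQ : IsFinAddProb (events Sig) Q)
    (t k : ℕ) : cellDensity P Q t k ≤ 1 :=
  div_le_one_of_le₀ (le_add_of_nonneg_left (hP.apply_nonneg _))
    (add_nonneg (hP.apply_nonneg _) (hQ.apply_nonneg _))

/-- Division by zero is harmless: if `P + Q` vanishes on the cell, so does `Q`. -/
theorem cellDensity_mul (hP : IsFinAddProb (events Sig) P) (hQ : IsFinAddProb (events Sig) Q)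
    (t k : ℕ) :
    cellDensity P Q t k * (P (pathCell t k) + Q (pathCell t k)) = Q (pathCell t k) := by
  have h1 := hP.apply_nonneg (pathCell t k)
  have h2 := hQ.apply_nonneg (pathCell t k)
  rcases eq_or_ne (P (pathCell t k) + Q (pathCell t k)) 0 with h | h
  · rw [h, mul_zero]
    linarith
  · exact div_mul_cancel₀ _ h

theorem sum_pathCell (hSig : cylinders ⊆ events Sig) (hP : IsFinAddProb (events Sig) P) (t : ℕ) :
    ∑ k ∈ Finset.range (2 ^ t), P (pathCell t k) = 1 := by
  have := hP.sum_inter_pathCell hSig (@MeasurableSet.univ _ Sig) t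
  simp only [univ_inter, hP.univ_eq_one] at this
  exact this.symm

/-- The squared density increments between two levels sum to the increment of the energies. -/
theorem sum_sq_cellDensity_sub (hSig : cylinders ⊆ events Sig) (hP : IsFinAddProb (events Sig) P)
    (hQ : IsFinAddProb (events Sig) Q) (t n : ℕ) :
    ∑ k ∈ Finset.range (2 ^ (t + n)),
      (cellDensity P Q (t + n) k - cellDensity P Q t (k / 2 ^ n)) ^ 2 *
        (P (pathCell (t + n) k) + Q (pathCell (t + n) k)) =
    ∑ k ∈ Finset.range (2 ^ (t + n)), cellDensity P Q (t + n) k * Q (pathCell (t + n) k) -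
    ∑ k ∈ Finset.range (2 ^ t), cellDensity P Q t k * Q (pathCell t k) := by
  -- Martingale orthogonality: in the expanded square, the terms with the coarse density sum to
  -- level `t` quantities.
  have h1 := sum_range_two_pow_refine (fun t k => Q (pathCell t k))
    (fun t k _ => hQ.pathCell_split hSig t k) t n (cellDensity P Q t)
  have h2 := sum_range_two_pow_refine (fun t k => P (pathCell t k) + Q (pathCell t k))
    (fun t k _ => by rw [hP.pathCell_split hSig t k, hQ.pathCell_split hSig t k]; ring) t n
    (fun k => cellDensity P Q t k ^ 2)
  have h3 : ∑ k ∈ Finset.range (2 ^ t),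
      cellDensity P Q t k ^ 2 * (P (pathCell t k) + Q (pathCell t k)) =
      ∑ k ∈ Finset.range (2 ^ t), cellDensity P Q t k * Q (pathCell t k) :=
    Finset.sum_congr rfl fun k _ => by rw [sq, mul_assoc, cellDensity_mul hP hQ]
  rw [h3] at h2
  have h4 : ∀ k, (cellDensity P Q (t + n) k - cellDensity P Q t (k / 2 ^ n)) ^ 2 *
        (P (pathCell (t + n) k) + Q (pathCell (t + n) k)) =
      cellDensity P Q (t + n) k * Q (pathCell (t + n) k) -
      2 * (cellDensity P Q t (k / 2 ^ n) * Q (pathCell (t + n) k)) +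
      cellDensity P Q t (k / 2 ^ n) ^ 2 *
        (P (pathCell (t + n) k) + Q (pathCell (t + n) k)) := by
    intro k
    have := cellDensity_mul hP hQ (t + n) k
    linear_combination
      (cellDensity P Q (t + n) k - 2 * cellDensity P Q t (k / 2 ^ n)) * this
  simp only [h4]
  rw [Finset.sum_add_distrib, Finset.sum_sub_distrib, ← Finset.mul_sum, h1, h2]
  ring

/-- The density is taken with respect to `P + Q` so that it lies in `[0, 1]`. The energies `H` are
then monotone and bounded, so their late increments are at most `κ ^ 2`. With `|x| ≤ x ^ 2 / κ + κ`
and total mass 2 this gives `κ + 2 κ`. -/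
theorem exists_sum_abs_cellDensity_sub_le (hSig : cylinders ⊆ events Sig)
    (hP : IsFinAddProb (events Sig) P) (hQ : IsFinAddProb (events Sig) Q) {κ : ℝ} (hκ : 0 < κ) :
    ∃ t₀, ∀ t ≥ t₀, ∀ n, ∑ k ∈ Finset.range (2 ^ (t + n)),
      |cellDensity P Q (t + n) k - cellDensity P Q t (k / 2 ^ n)| *
        (P (pathCell (t + n) k) + Q (pathCell (t + n) k)) ≤ 3 * κ := by
  have hm : ∀ t k, 0 ≤ P (pathCell t k) + Q (pathCell t k) := fun t k =>
    add_nonneg (hP.apply_nonneg _) (hQ.apply_nonneg _)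
  let H : ℕ → ℝ := fun t => ∑ k ∈ Finset.range (2 ^ t), cellDensity P Q t k * Q (pathCell t k)
  have hH1 : BddAbove (range H) := by
    refine ⟨1, ?_⟩
    rintro _ ⟨t, rfl⟩
    rw [← sum_pathCell hSig hQ t]
    exact Finset.sum_le_sum fun k _ =>
      mul_le_of_le_one_left (hQ.apply_nonneg _) (cellDensity_le_one hP hQ t k)
  have hHmono : Monotone H := by
    intro s t hst
    obtain ⟨n, rfl⟩ := Nat.exists_eq_add_of_le hst
    have h := sum_sq_cellDensity_sub hSig hP hQ s n
    have h0 : 0 ≤ H (s + n) - H s :=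
      (Finset.sum_nonneg fun k _ => mul_nonneg (sq_nonneg _) (hm _ _)).trans h.le
    linarith
  obtain ⟨t₀, ht₀⟩ := exists_lt_of_lt_ciSup (show (⨆ t, H t) - κ ^ 2 < ⨆ t, H t by
    linarith [pow_pos hκ 2])
  refine ⟨t₀, fun t ht n => ?_⟩
  have henergy : H (t + n) - H t ≤ κ ^ 2 := by
    linarith [hHmono ht, le_ciSup hH1 (t + n)]
  have hpt : ∀ x : ℝ, |x| ≤ x ^ 2 / κ + κ := by
    intro x
    rw [div_add' _ _ _ hκ.ne', le_div_iff₀ hκ, ← sq_abs]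
    nlinarith [sq_nonneg (|x| - κ), abs_nonneg x]
  calc ∑ k ∈ Finset.range (2 ^ (t + n)),
      |cellDensity P Q (t + n) k - cellDensity P Q t (k / 2 ^ n)| *
        (P (pathCell (t + n) k) + Q (pathCell (t + n) k))
      ≤ ∑ k ∈ Finset.range (2 ^ (t + n)),
        ((cellDensity P Q (t + n) k - cellDensity P Q t (k / 2 ^ n)) ^ 2 *
          (P (pathCell (t + n) k) + Q (pathCell (t + n) k)) / κ +
          κ * (P (pathCell (t + n) k) + Q (pathCell (t + n) k))) := by
        refine Finset.sum_le_sum fun k _ => ?_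
        refine (mul_le_mul_of_nonneg_right (hpt _) (hm _ _)).trans_eq ?_
        ring
    _ = (H (t + n) - H t) / κ + κ * (1 + 1) := by
        rw [Finset.sum_add_distrib, ← Finset.sum_div, ← Finset.mul_sum, Finset.sum_add_distrib,
          sum_pathCell hSig hP, sum_pathCell hSig hQ, sum_sq_cellDensity_sub hSig hP hQ]
    _ ≤ κ ^ 2 / κ + κ * (1 + 1) := by gcongr
    _ = 3 * κ := by
        field_simp
        norm_num

theorem densityDefect_inter_add_diff (hSig : cylinders ⊆ events Sig)
    (hP : IsFinAddProb (events Sig) P) (hQ : IsFinAddProb (events Sig) Q) (t : ℕ)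
    {F G : Set BinPath} (hF : MeasurableSet[Sig] F) (hG : MeasurableSet[Sig] G) :
    densityDefect P Q t (F ∩ G) + densityDefect P Q t (F \ G) = densityDefect P Q t F := by
  simp only [densityDefect]
  rw [← Finset.sum_add_distrib]
  refine Finset.sum_congr rfl fun k _ => ?_
  have hFC := hF.inter (measurableSet_pathCell hSig t k)
  rw [← hP.inter_add_diff hFC hG, ← hQ.inter_add_diff hFC hG, inter_right_comm,
    sdiff_inter_right_comm]
  ring

theorem densityDefect_le (hSig : cylinders ⊆ events Sig)
    (hP : IsFinAddProb (events Sig) P) (hQ : IsFinAddProb (events Sig) Q) (t : ℕ)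
    {F : Set BinPath} (hF : MeasurableSet[Sig] F) : densityDefect P Q t F ≤ Q F := by
  rw [hQ.sum_inter_pathCell hSig hF t]
  refine Finset.sum_le_sum fun k _ => ?_
  have h := cellDensity_nonneg hP hQ t k
  have h1 := mul_nonneg h (hP.apply_nonneg (F ∩ pathCell t k))
  have h2 := mul_nonneg h (hQ.apply_nonneg (F ∩ pathCell t k))
  linarith

theorem neg_le_densityDefect (hSig : cylinders ⊆ events Sig)
    (hP : IsFinAddProb (events Sig) P) (hQ : IsFinAddProb (events Sig) Q) (t : ℕ)
    {F : Set BinPath} (hF : MeasurableSet[Sig] F) : -P F ≤ densityDefect P Q t F := by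
  rw [hP.sum_inter_pathCell hSig hF t, ← Finset.sum_neg_distrib]
  refine Finset.sum_le_sum fun k _ => ?_
  have h := sub_nonneg.2 (cellDensity_le_one hP hQ t k)
  have h1 := mul_nonneg h (hP.apply_nonneg (F ∩ pathCell t k))
  have h2 := mul_nonneg h (hQ.apply_nonneg (F ∩ pathCell t k))
  linarith

/-- On a cell of level `t + n` inside the clopen set, the defect is the density increment times the
mass; the other cells contribute nothing. -/
theorem densityDefect_preimage_le (hSig : cylinders ⊆ events Sig)
    (hP : IsFinAddProb (events Sig) P) (hQ : IsFinAddProb (events Sig) Q) (t n : ℕ) (S : Set ℕ) :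
    densityDefect P Q t (pathCode n ⁻¹' S) ≤ ∑ k ∈ Finset.range (2 ^ (t + n)),
      |cellDensity P Q (t + n) k - cellDensity P Q t (k / 2 ^ n)| *
        (P (pathCell (t + n) k) + Q (pathCell (t + n) k)) := by
  have hA := measurableSet_pathCode_preimage hSig n S
  set A := pathCode n ⁻¹' S with hAdef
  have h1 := sum_range_two_pow_refine (fun s k => P (A ∩ pathCell s k))
    (fun s k _ => hP.inter_pathCell_split hSig hA s k) t n (cellDensity P Q t)
  have h2 := sum_range_two_pow_refine (fun s k => Q (A ∩ pathCell s k))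
    (fun s k _ => hQ.inter_pathCell_split hSig hA s k) t n (fun k => 1 - cellDensity P Q t k)
  rw [densityDefect, Finset.sum_sub_distrib, ← h1, ← h2, ← Finset.sum_sub_distrib]
  refine Finset.sum_le_sum fun k _ => ?_
  have hm : 0 ≤ P (pathCell (t + n) k) + Q (pathCell (t + n) k) :=
    add_nonneg (hP.apply_nonneg _) (hQ.apply_nonneg _)
  -- `k / 2 ^ t` is the ancestor at level `n`, which decides membership in `A`; `k / 2 ^ n` is the
  -- one at level `t`.
  by_cases hk : k / 2 ^ t ∈ S
  · have hAk : A ∩ pathCell (t + n) k = pathCell (t + n) k := by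
      rw [add_comm t n]
      exact preimage_inter_pathCell_of_mem hk
    simp only [hAk]
    refine le_trans (le_of_eq ?_) (mul_le_mul_of_nonneg_right (le_abs_self _) hm)
    linear_combination -cellDensity_mul hP hQ (t + n) k
  · have hAk : A ∩ pathCell (t + n) k = ∅ := by
      rw [add_comm t n]
      exact preimage_inter_pathCell_of_notMem hk
    simp only [hAk, hP.apply_empty, hQ.apply_empty, mul_zero, sub_zero]
    exact mul_nonneg (abs_nonneg _) hm

/-- Replacing `E` by a clopen `A` costs at most `Q (E \ A) + P (A \ E) ≤ 2 κ`, on top of `3 κ` for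
`A`. The level of `A` is irrelevant, so `t₀` serves all events. -/
theorem exists_densityDefect_le (hSig : cylinders ⊆ events Sig)
    (hP : IsFinAddProb (events Sig) P) (hQ : IsFinAddProb (events Sig) Q) (hQP : AbsCont Sig Q P)
    (happrox : ∀ E ∈ events Sig, ∀ ε : ℝ, 0 < ε →
      ∃ (t : ℕ) (S : Set ℕ), P (E \ pathCode t ⁻¹' S) + P (pathCode t ⁻¹' S \ E) < ε)
    {κ : ℝ} (hκ : 0 < κ) :
    ∃ t₀, ∀ t ≥ t₀, ∀ E ∈ events Sig, densityDefect P Q t E ≤ 5 * κ := by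
  obtain ⟨t₀, ht₀⟩ := exists_sum_abs_cellDensity_sub_le hSig hP hQ hκ
  obtain ⟨δ, hδ, hδQ⟩ := hQP.exists_forall_lt hP hκ
  refine ⟨t₀, fun t ht E hE => ?_⟩
  obtain ⟨n, S, hS⟩ := happrox E hE (min δ κ) (lt_min hδ hκ)
  have hA := measurableSet_pathCode_preimage hSig n S
  have hN := (densityDefect_preimage_le hSig hP hQ t n S).trans (ht₀ t ht n)
  set A := pathCode n ⁻¹' S
  replace hE : MeasurableSet[Sig] E := hE
  have h0 := hP.apply_nonneg (E \ A)
  have h1 := hP.apply_nonneg (A \ E)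
  have hQEA : Q (E \ A) < κ := hδQ _ (hE.diff hA) (by linarith [min_le_left δ κ])
  have h2 := densityDefect_inter_add_diff hSig hP hQ t hE hA
  have h3 := densityDefect_inter_add_diff hSig hP hQ t hA hE
  rw [inter_comm] at h3
  linarith [densityDefect_le hSig hP hQ t (hE.diff hA),
    neg_le_densityDefect hSig hP hQ t (hA.diff hE), min_le_right δ κ]

/-- If the forecasts conditional on `C` are more than `ε` apart, then some event witnesses this
with the forecast of `Q` above that of `P`. -/
theorem exists_event_of_lt_iSup (hP : IsFinAddProb (events Sig) P)
    (hQ : IsFinAddProb (events Sig) Q) {C : Set BinPath} (hC : MeasurableSet[Sig] C) {ε : ℝ}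
    (h : ε < ⨆ E : events Sig, |condProb P E C - condProb Q E C|) :
    ∃ F ∈ events Sig, ε * (P C * Q C) ≤ P C * Q (F ∩ C) - Q C * P (F ∩ C) := by
  have hempty : (∅ : Set BinPath) ∈ events Sig := @MeasurableSet.empty _ Sig
  -- If `P C` or `Q C` is zero, `condProb` is meaningless, but the product form holds for `∅` as `0
  -- ≤ 0`.
  rcases (hP.apply_nonneg C).eq_or_lt with hp | hp
  · exact ⟨∅, hempty, by simp [← hp, hP.apply_empty]⟩
  rcases (hQ.apply_nonneg C).eq_or_lt with hq | hq
  · exact ⟨∅, hempty, by simp [← hq, hQ.apply_empty]⟩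
  have : Nonempty (events Sig) := ⟨⟨∅, hempty⟩⟩
  obtain ⟨⟨E, hE⟩, h⟩ := exists_lt_of_lt_ciSup h
  have hE' : MeasurableSet[Sig] E := hE
  simp only [condProb] at h
  have hP1 := hP.inter_add_diff hC hE'
  have hQ1 := hQ.inter_add_diff hC hE'
  have h1 : P (E ∩ C) / P C * (P C * Q C) = Q C * P (E ∩ C) := by field_simp
  have h2 : Q (E ∩ C) / Q C * (P C * Q C) = P C * Q (E ∩ C) := by field_simp
  have hpq : 0 < P C * Q C := mul_pos hp hq
  rcases lt_abs.1 h with h | h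
  -- Passing to the complement reverses the sign of the difference.
  · refine ⟨Eᶜ, hE'.compl, ?_⟩
    rw [inter_comm Eᶜ C, ← sdiff_eq]
    rw [inter_comm] at hP1 hQ1
    have := mul_le_mul_of_nonneg_right h.le hpq.le
    rw [sub_mul, h1, h2] at this
    have e1 : P (C \ E) = P C - P (E ∩ C) := by linarith
    have e2 : Q (C \ E) = Q C - Q (E ∩ C) := by linarith
    rw [e1, e2]
    linarith
  · refine ⟨E, hE, ?_⟩
    have := mul_le_mul_of_nonneg_right h.le hpq.le
    rw [neg_sub, sub_mul, h1, h2] at this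
    exact this

theorem blackwellDubins_of_approx (hSig : cylinders ⊆ events Sig)
    (hP : IsFinAddProb (events Sig) P)
    (happrox : ∀ E ∈ events Sig, ∀ ε : ℝ, 0 < ε →
      ∃ (t : ℕ) (S : Set ℕ), P (E \ pathCode t ⁻¹' S) + P (pathCode t ⁻¹' S \ E) < ε) :
    BlackwellDubins Sig P := by
  intro Q hQ hQP ε hε
  rw [Metric.tendsto_atTop]
  intro ρ hρ
  obtain ⟨δ, hδ, hδQ⟩ := hQP.exists_forall_lt hP (half_pos hρ)
  -- Cells with `Q > K P` have total `P`-mass at most `1 / K < δ`, hence `Q`-mass below `ρ / 2`.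
  obtain ⟨K, hK⟩ := exists_gt (1 / δ)
  have hK0 : 0 < K := (one_div_pos.2 hδ).trans hK
  -- Chosen so that `(1 + K) / ε * (5 * κ) = ρ / 4`.
  obtain ⟨t₀, ht₀⟩ := exists_densityDefect_le hSig hP hQ hQP happrox
    (κ := ρ * ε / (20 * (1 + K))) (by positivity)
  refine ⟨t₀, fun t ht => ?_⟩
  rw [Real.dist_0_eq_abs, abs_of_nonneg (hQ.apply_nonneg _)]
  have hC := measurableSet_pathCell hSig t
  let S : Set ℕ := {k | ε < ⨆ E : events Sig,
    |condProb P E (pathCell t k) - condProb Q E (pathCell t k)|}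
  have hB : {ω | ε < forecastDist Sig P Q ω t} = pathCode t ⁻¹' S := by
    ext ω
    simp only [mem_ofPred_eq, forecastDist, cyl_eq_pathCell, mem_preimage, S]
  rw [hB]
  have hF : ∀ k, ∃ F ∈ events Sig,
      0 ≤ P (pathCell t k) * Q (F ∩ pathCell t k) - Q (pathCell t k) * P (F ∩ pathCell t k) ∧
      (k ∈ S → ε * (P (pathCell t k) * Q (pathCell t k)) ≤
        P (pathCell t k) * Q (F ∩ pathCell t k) - Q (pathCell t k) * P (F ∩ pathCell t k)) := by
    intro k
    by_cases hk : k ∈ S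
    · obtain ⟨F, hF, h⟩ := exists_event_of_lt_iSup hP hQ (hC k) hk
      exact ⟨F, hF, le_trans (mul_nonneg hε.le (mul_nonneg (hP.apply_nonneg _)
        (hQ.apply_nonneg _))) h, fun _ => h⟩
    · exact ⟨∅, @MeasurableSet.empty _ Sig, by simp [hP.apply_empty, hQ.apply_empty],
        fun h => absurd h hk⟩
  choose F hFm hF0 hFS using hF
  -- Gluing the witnesses cell by cell turns the separate suprema into the defect of a single event.
  let E : Set BinPath := ⋃ k, F k ∩ pathCell t k
  have hE : MeasurableSet[Sig] E :=
    MeasurableSet.iUnion fun k => MeasurableSet.inter (m := Sig) (hFm k) (hC k)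
  have hEC : ∀ k, E ∩ pathCell t k = F k ∩ pathCell t k := by
    intro k
    ext ω
    simp only [E, mem_inter_iff, mem_iUnion, mem_pathCell]
    constructor
    · rintro ⟨⟨j, h1, rfl⟩, rfl⟩
      exact ⟨h1, rfl⟩
    · rintro ⟨h1, rfl⟩
      exact ⟨⟨_, h1, rfl⟩, rfl⟩
  let G : Set ℕ := {k | K * P (pathCell t k) < Q (pathCell t k)}
  have hBm := measurableSet_pathCode_preimage hSig t S
  have hGm := measurableSet_pathCode_preimage hSig t G
  have cell_mem : ∀ {T : Set ℕ} {k}, k ∈ T →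
      pathCode t ⁻¹' T ∩ pathCell t k = pathCell t k := fun {T k} h =>
    preimage_inter_pathCell_of_mem (m := 0) (by simpa using h)
  have cell_notMem : ∀ {T : Set ℕ} {k}, k ∉ T →
      pathCode t ⁻¹' T ∩ pathCell t k = ∅ := fun {T k} h =>
    preimage_inter_pathCell_of_notMem (m := 0) (by simpa using h)
  have hG : Q (pathCode t ⁻¹' G) < ρ / 2 := by
    refine hδQ _ hGm ?_
    have h1 : K * P (pathCode t ⁻¹' G) ≤ Q (pathCode t ⁻¹' G) := by
      rw [hP.sum_inter_pathCell hSig hGm t, hQ.sum_inter_pathCell hSig hGm t, Finset.mul_sum]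
      refine Finset.sum_le_sum fun k _ => ?_
      by_cases hk : k ∈ G
      · rw [cell_mem hk]
        exact le_of_lt hk
      · rw [cell_notMem hk, hP.apply_empty, hQ.apply_empty, mul_zero]
    have h2 : P (pathCode t ⁻¹' G) ≤ 1 / K := by
      rw [le_div_iff₀ hK0, mul_comm]
      exact h1.trans (hQ.le_one _)
    exact h2.trans_lt ((one_div_lt hδ hK0).1 hK)
  have hmain : Q (pathCode t ⁻¹' S) ≤
      Q (pathCode t ⁻¹' G) + (1 + K) / ε * densityDefect P Q t E := by
    rw [hQ.sum_inter_pathCell hSig hBm t, hQ.sum_inter_pathCell hSig hGm t, densityDefect,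
      Finset.mul_sum, ← Finset.sum_add_distrib]
    refine Finset.sum_le_sum fun k _ => ?_
    rw [hEC]
    have hp := hP.apply_nonneg (pathCell t k)
    have hq := hQ.apply_nonneg (pathCell t k)
    have hm := cellDensity_mul hP hQ t k
    have h0 := hF0 k
    have hS := hFS k
    have hFQ := hQ.apply_nonneg (F k ∩ pathCell t k)
    have hfrac : 0 < (1 + K) / ε := by positivity
    set D := (1 - cellDensity P Q t k) * Q (F k ∩ pathCell t k) -
      cellDensity P Q t k * P (F k ∩ pathCell t k) with hD
    have hDm : (P (pathCell t k) + Q (pathCell t k)) * D =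
        P (pathCell t k) * Q (F k ∩ pathCell t k) - Q (pathCell t k) * P (F k ∩ pathCell t k) := by
      rw [hD]
      linear_combination (-Q (F k ∩ pathCell t k) - P (F k ∩ pathCell t k)) * hm
    have hD0 : 0 ≤ D := by
      rcases (add_nonneg hp hq).eq_or_lt with h | h
      · rw [hD, cellDensity, ← h, div_zero]
        linarith
      · exact nonneg_of_mul_nonneg_right (hDm ▸ h0) h
    by_cases hkS : k ∈ S
    · rw [cell_mem hkS]
      by_cases hkG : k ∈ G
      · rw [cell_mem hkG]
        exact le_add_of_nonneg_right (mul_nonneg hfrac.le hD0)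
      · rw [cell_notMem hkG, hQ.apply_empty, zero_add]
        have hqK : Q (pathCell t k) ≤ K * P (pathCell t k) := not_lt.1 hkG
        rcases (add_nonneg hp hq).eq_or_lt with h | h
        · have : Q (pathCell t k) = 0 := by linarith
          rw [this]
          exact mul_nonneg hfrac.le hD0
        -- Here `P + Q ≤ (1 + K) P`, so `ε P Q ≤ (P + Q) D` gives `ε Q ≤ (1 + K) D`.
        · rw [div_mul_eq_mul_div, le_div_iff₀ hε]
          refine le_of_mul_le_mul_left ?_ h
          have h1 : (1 + K) * (ε * (P (pathCell t k) * Q (pathCell t k))) ≤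
              (1 + K) * ((P (pathCell t k) + Q (pathCell t k)) * D) := by
            rw [hDm]
            exact mul_le_mul_of_nonneg_left (hS hkS) (by positivity)
          have h2 : (P (pathCell t k) + Q (pathCell t k)) * (Q (pathCell t k) * ε) ≤
              ((1 + K) * P (pathCell t k)) * (Q (pathCell t k) * ε) :=
            mul_le_mul_of_nonneg_right (by linarith) (mul_nonneg hq hε.le)
          linarith
    · rw [cell_notMem hkS, hQ.apply_empty]
      exact add_nonneg (hQ.apply_nonneg _) (mul_nonneg hfrac.le hD0)
  have hend : (1 + K) / ε * densityDefect P Q t E ≤ ρ / 4 := by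
    refine (mul_le_mul_of_nonneg_left (ht₀ t ht E hE) (by positivity)).trans_eq ?_
    field_simp
    norm_num
  linarith

end

/-! ### Conclusion -/

theorem smallLargeAlgebra_subset_events {Sig : MeasurableSpace BinPath}
    (hSig : cylinders ⊆ events Sig) (I : Set (Set BinPath)) :
    smallLargeAlgebra Sig I ⊆ events Sig := by
  intro A hA
  induction hA with
  | base s hs =>
    rcases hs with hs | hs
    · exact hSig hs
    · exact hs.1
  | empty => exact @MeasurableSet.empty _ Sig
  | compl s _ ih => exact MeasurableSet.compl (m := Sig) ih
  | union s t _ _ ihs iht => exact MeasurableSet.union (m := Sig) ihs iht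

theorem theorem4 (Sig : MeasurableSpace BinPath) (hSig : cylinders ⊆ events Sig)
    (I : Set (Set BinPath)) (hI : IsStrictlyProperIdeal I) :
    ∃ P ∈ DeltaBD Sig, (∀ E ∈ events Sig, E ∈ I → P E = 0) ∧
      ∃ p : Set BinPath → ℝ, IsFinAddProb (smallLargeAlgebra Sig I) p ∧
        P ∈ (extensions p (smallLargeAlgebra Sig I) (events Sig)).extremePoints ℝ := by
  classical
  obtain ⟨P, hP⟩ := (isCompact_uniformNullExtensions Sig I).extremePoints_nonempty
    (uniformNullExtensions_nonempty hSig hI)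
  obtain ⟨hprob, hcell, hnull⟩ := hP.1
  have halg : MeasureTheory.IsSetAlgebra (smallLargeAlgebra Sig I) :=
    MeasureTheory.isSetAlgebra_generateSetAlgebra
  have hgen := MeasureTheory.self_subset_generateSetAlgebra
    (𝒜 := cylinders ∪ {E ∈ events Sig | E ∈ I ∨ Eᶜ ∈ I})
  have hsub := smallLargeAlgebra_subset_events hSig I
  let p : Set BinPath → ℝ := fun A => if A ∈ smallLargeAlgebra Sig I then P A else 0
  have hp : ∀ A ∈ smallLargeAlgebra Sig I, p A = P A := fun A hA => if_pos hA
  refine ⟨P, ⟨⟨hprob, stronglyNonatomic_of_pathCell hSig hprob hcell⟩,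
    blackwellDubins_of_approx hSig hprob fun E hE ε hε =>
      exists_pathCode_preimage_approx hSig hP hE hε⟩, hnull, p,
    ⟨fun A hA => ?_, ?_, fun A hA B hB hAB => ?_, fun A hA => if_neg hA⟩,
    -- Every extension of `p` agrees with `P` on cylinders and on events of `I`, so it lies in
    -- `uniformNullExtensions`; extremality passes to a subset containing `P`.
    inter_extremePoints_subset_extremePoints_of_subset (A := uniformNullExtensions Sig I)
      ?_ ⟨⟨hprob, fun A hA => (hp A hA).symm⟩, hP⟩⟩
  · rw [hp A hA]
    exact hprob.apply_nonneg A
  · rw [hp _ halg.univ_mem, hprob.univ_eq_one]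
  · rw [hp _ (halg.union_mem hA hB), hp A hA, hp B hB,
      hprob.union_eq A (hsub hA) B (hsub hB) hAB]
  · rintro Q ⟨hQ, hQp⟩
    refine ⟨hQ, fun t k hk => ?_, fun E hE hEI => ?_⟩
    · have hmem := hgen (Or.inl (pathCell_mem_cylinders hk))
      rw [hQp _ hmem, hp _ hmem, hcell t k hk]
    · have hmem := hgen (Or.inr ⟨hE, Or.inl hEI⟩)
      rw [hQp _ hmem, hp _ hmem, hnull E hE hEI]
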